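/- Let $n\ge 1$ and $\beta\in\mathbb C$. The periodic Temperley–Lieb algebra $\mathsf{pTL}_n(\beta)$ is the unital associative $\mathbb C$-algebra with generators $e_0,\dots,e_{n-1}$ (indices modulo $n$; no generators if $n=1$) and relations $e_j^2=\beta e_j$, $e_je_{j\pm1}e_j=e_j$ (imposed only if $n\ge 3$), and $e_ie_j=e_je_i$ if $i\neq j$ and $i,j$ are not adjacent modulo $n$. Let $0\le d\le n$ with $d\equiv n \pmod 2$, and let $z\in\mathbb C^\times$. A link state with $n$ nodes and $d$ defects is a planar diagram above a horizontal segment with nodes $1,\dots,n$ and periodic boundary condition in the horizontal direction: $d$ nodes carry vertical defects that extend to infinity, and the other nodes are connected pairwise by non-intersecting arcs that do not overarch any defect (arcs may cross the periodic boundary, between the nodes $n$ and $1$). The standard module $\mathsf W_{n,d,z}$ over $\mathsf{pTL}_n(\beta)$ is the free complex vector space on these link states. The generator $e_j$ is the diagram with an arc joining the nodes $j,j+1$ (modulo $n$) on its top edge, an arc joining the same nodes on its bottom edge, and vertical lines elsewhere; the arcs of $e_0$ cross the periodic boundary. For a link state $v$, $e_j\cdot v$ is obtained by drawing $v$ above $e_j$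 and reading off the link state at the bottom. The result is $0$ if two defects get connected. Otherwise it is multiplied by $\beta$ for each contractible loop, by $z+z^{-1}$ for each non-contractible loop (possible only for $d=0$), and by $z$ (resp. $z^{-1}$) each time a defect, followed downwards, crosses the periodic boundary towards the left (resp. right). For a link state $v$ let $\sigma_v=0$ if an odd number of arcs of $v$ cross the periodic boundary, and $\sigma_v=1$ if this number is even. Then the linear map $\mathsf W_{n,d,z}\to\mathsf W_{n,d,-z}$ that sends each link state $v$ to $(-1)^{\sigma_v}v$ is an isomorphism of $\mathsf{pTL}_n(\beta)$-modules. In particular $\mathsf W_{n,d,z}\simeq\mathsf W_{n,d,-z}$ over $\mathsf{pTL}_n(\beta)$. -/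

import Mathlib

namespace PeriodicTL

set_option linter.all false

/-! Diagrams with periodic boundary conditions on `n` nodes are drawn on the universal cover of the
annulus: the nodes are the integers, the node `i` lies over the node of `{1, …, n}` congruent to it
modulo `n`, and the boundary condition is crossed between `k * n` and `k * n + 1`. -/

/-- The periodic involution of `ℤ` that exchanges `a + k * n` and `b + k * n` for every `k`. For
`b = a + 1` these are the arcs of the generator `e_a`, lifted to the cover. -/
def swap (n : ℕ) (a b i : ℤ) : ℤ :=
  if (n : ℤ) ∣ i - a then i + (b - a)
  else if (n : ℤ) ∣ i - b then i + (a - b)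
  else i

/-- Stacking the pairing `f` (a fixed point is a defect) above the generator whose arcs are given by
`swap n a b`. A node which is on the bottom arc is joined to the other end of that arc. Any other
node is followed upwards through the vertical line of the generator and then along `f`; if it
arrives at an upper arc of the generator, it is followed along this arc and along `f` once more.
It ends at the bottom or, in a defect of `f`, at infinity. -/
def glue (n : ℕ) (a b : ℤ) (f : ℤ → ℤ) (i : ℤ) : ℤ :=
  if swap n a b i ≠ i then swap n a b i
  else if swap n a b (f i) = f i then f i
  else if f (swap n a b (f i)) = swap n a b (f i) then i
  else f (swap n a b (f i))

/-- The number of the copy `{k * n + 1, …, k * n + n}` of the fundamental domain containing `i`. -/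
def cell (n : ℕ) (i : ℤ) : ℤ := (i - 1) / n

/-- The prefactor that comes with `glue n a b f` (used for `b = a + 1`).
* `f a = b`: a contractible loop is closed, factor `β`;
* `f a` is another translate of `b`: a non-contractible loop is closed, factor `z + z⁻¹`;
* `a` and `b` both carry defects: two defects are attached, factor `0`;
* only `a` carries a defect: that defect now ends at the node `f b`, and there is one factor `z` for
  each crossing of the boundary condition to the left when the defect is followed downwards, and
  one factor `z⁻¹` for each crossing to the right; likewise for `b`;
* in all other cases the factor is `1`. -/
noncomputable def weight (n : ℕ) (β : ℂ) (z : ℂˣ) (a b : ℤ) (f : ℤ → ℤ) : ℂ :=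
  if f a = b then β
  else if (n : ℤ) ∣ f a - b then (z : ℂ) + (z : ℂ)⁻¹
  else if f a = a ∧ f b = b then 0
  else if f a = a then (z : ℂ) ^ (cell n a - cell n (f b))
  else if f b = b then (z : ℂ) ^ (cell n b - cell n (f a))
  else 1

/-- `f` is a periodic pairing of the nodes. -/
structure Per (n : ℕ) (f : ℤ → ℤ) : Prop where
  inv : ∀ i, f (f i) = i
  per : ∀ i, f (i + n) = f i + n

variable {n : ℕ}

theorem Per.mul {f} (h : Per n f) (i k : ℤ) : f (i + k * n) = f i + k * n := by
  induction k using Int.induction_on with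
  | zero => simp
  | succ k ih =>
    have := h.per (i + k * n)
    rw [show i + ((k:ℤ) + 1) * n = i + k * n + n by ring, this, ih]; ring
  | pred k ih =>
    have := h.per (i + (-(k:ℤ) - 1) * n)
    rw [show i + (-(k:ℤ) - 1) * n + n = i + -k * n by ring, ih] at this
    linarith

theorem Per.sub {f} (h : Per n f) {x y : ℤ} (hd : (n:ℤ) ∣ x - y) : f x = f y + (x - y) := by
  obtain ⟨k, hk⟩ := hd
  have := h.mul y k
  rw [show x = y + k * n by linarith, this]; ring

theorem Per.fix {f} (h : Per n f) {x : ℤ} (hd : (n:ℤ) ∣ f x - x) : f x = x := by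
  have := h.sub hd
  rw [h.inv] at this
  linarith

theorem dvd_symm {x y : ℤ} (h : (n:ℤ) ∣ x - y) : (n:ℤ) ∣ y - x := (dvd_sub_comm).1 h
theorem dvd_tr {x y z : ℤ} (h : (n:ℤ) ∣ x - y) (h' : (n:ℤ) ∣ y - z) : (n:ℤ) ∣ x - z := by
  have := dvd_add h h'; simpa using this

section
variable {a b : ℤ}


theorem swap_symm (hab : ¬ (n:ℤ) ∣ a - b) (x : ℤ) : swap n a b x = swap n b a x := by
  unfold swap
  split_ifs with h1 h2 <;> try rfl
  exact absurd (dvd_tr (dvd_symm h1) h2) hab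

theorem ne_of_nd (hab : ¬ (n:ℤ) ∣ a - b) : a ≠ b := by rintro rfl; simp at hab

theorem swap_ne (hab : ¬ (n:ℤ) ∣ a - b) (x : ℤ) : swap n a b x ≠ x ↔ ((n:ℤ) ∣ x - a ∨ (n:ℤ) ∣ x - b) := by
  have := ne_of_nd hab
  unfold swap
  split_ifs with h1 h2 <;> simp [*] <;> omega

theorem swap_swap (hab : ¬ (n:ℤ) ∣ a - b) (x : ℤ) : swap n a b (swap n a b x) = x := by
  have e1 (h : (n:ℤ) ∣ x - a) : swap n a b x = x + (b - a) := by simp [swap, h]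
  have e2 (h : (n:ℤ) ∣ x - b) : swap n a b x = x + (a - b) := by
    rw [swap_symm hab]; simp [swap, h]
  by_cases h1 : (n:ℤ) ∣ x - a
  · rw [e1 h1, swap_symm hab]; simp [swap, show x + (b - a) - b = x - a by ring, h1]; ring
  by_cases h2 : (n:ℤ) ∣ x - b
  · rw [e2 h2]; simp [swap, show x + (a - b) - a = x - b by ring, h2]; ring
  simp [swap, h1, h2]

theorem swap_not_dvd (hab : ¬ (n:ℤ) ∣ a - b) {x : ℤ} (h : (n:ℤ) ∣ swap n a b x - x) : swap n a b x = x := by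
  unfold swap at *
  split_ifs at h ⊢ with h1 h2 <;> try rfl
  · exact absurd (dvd_symm (by simpa using h)) hab
  · exact absurd (by simpa using h) hab

theorem swap_tt (hab : ¬ (n:ℤ) ∣ a - b) {x y : ℤ} (hx : swap n a b x ≠ x) (hy : swap n a b y ≠ y) :
    (n:ℤ) ∣ x - y ∨ (n:ℤ) ∣ swap n a b x - y := by
  rw [swap_ne hab] at hx hy
  by_cases h1 : (n:ℤ) ∣ x - a
  · have : swap n a b x = x + (b - a) := by simp [swap, h1]
    rcases hy with hy | hy
    · exact .inl (dvd_tr h1 (dvd_symm hy))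
    · right; rw [this]
      have h := dvd_sub h1 hy; rwa [show x - a - (y - b) = x + (b - a) - y by ring] at h
  · have h2 := hx.resolve_left h1
    have : swap n a b x = x + (a - b) := by simp [swap, h1, h2]
    rcases hy with hy | hy
    · right; rw [this]
      have h := dvd_sub h2 hy; rwa [show x - b - (y - a) = x + (a - b) - y by ring] at h
    · exact .inl (dvd_tr h2 (dvd_symm hy))

theorem swap_tr (hab : ¬ (n:ℤ) ∣ a - b) {x y : ℤ} (hx : swap n a b x ≠ x) (hy : (n:ℤ) ∣ x - y) : swap n a b y ≠ y := by
  rw [swap_ne hab] at hx ⊢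
  exact hx.imp (dvd_tr (dvd_symm hy)) (dvd_tr (dvd_symm hy))

theorem swap_per (x : ℤ) : swap n a b (x + n) = swap n a b x + n := by
  have e (c : ℤ) : (n:ℤ) ∣ x + n - c ↔ (n:ℤ) ∣ x - c := by
    rw [show x + n - c = x - c + n by ring]; simp
  unfold swap
  simp only [e]
  split_ifs <;> ring

end

theorem glue_moved {a b : ℤ} {f : ℤ → ℤ} {x : ℤ} (h : swap n a b x ≠ x) :
    glue n a b f x = swap n a b x := by simp [glue, h]

theorem glue_free {a b : ℤ} {f : ℤ → ℤ} {x : ℤ} (h : swap n a b x = x)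
    (h' : swap n a b (f x) = f x) : glue n a b f x = f x := by simp [glue, h, h']

theorem glue_path {a b : ℤ} {f : ℤ → ℤ} {x : ℤ} (h : swap n a b x = x)
    (h' : swap n a b (f x) ≠ f x) : glue n a b f x =
      if f (swap n a b (f x)) = swap n a b (f x) then x else f (swap n a b (f x)) := by
  simp [glue, h, h']

theorem glue_per {a b : ℤ} (hab : ¬ (n:ℤ) ∣ a - b) {f : ℤ → ℤ} (hf : Per n f) :
    Per n (glue n a b f) where
  inv x := by
    have ss := swap_swap hab
    by_cases hx : swap n a b x = x
    swap
    · rw [glue_moved hx, glue_moved (by rw [ss]; exact Ne.symm hx), ss]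
    by_cases hy : swap n a b (f x) = f x
    · rw [glue_free hx hy, glue_free hy (by rw [hf.inv]; exact hx), hf.inv]
    rw [glue_path hx hy]
    split_ifs with h
    · rw [glue_path hx hy, if_pos h]
    set k := swap n a b (f x) with hk
    have hkk : swap n a b k ≠ k := by rw [hk, ss]; exact Ne.symm hy
    have hw : swap n a b (f k) = f k := by
      by_contra hw
      rcases swap_tt hab hy hw with h1 | h1
      · rw [← hk] at *
        have := hf.sub h1
        rw [hf.inv, hf.inv] at this
        exact swap_tr hab hkk (y := x) (by rw [this]; simpa using dvd_symm h1) hx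
      · rw [← hk] at h1
        exact h (hf.fix (dvd_symm h1))
    have e : swap n a b k = f x := ss _
    rw [glue_path hw (by rw [hf.inv]; exact hkk), hf.inv, e, hf.inv, if_neg]
    intro h'; exact hy (by rw [hk, ← h']; exact hx)
  per x := by
    unfold glue
    have := hf.per
    simp only [this, swap_per, ne_eq, add_left_inj]
    split_ifs <;> rfl

section
variable {a b a' b' : ℤ}


theorem swap_disj (hab : ¬ (n:ℤ) ∣ a - b) (hab' : ¬ (n:ℤ) ∣ a' - b') (h1 : ¬ (n:ℤ) ∣ a - a') (h2 : ¬ (n:ℤ) ∣ a - b') (h3 : ¬ (n:ℤ) ∣ b - a') (h4 : ¬ (n:ℤ) ∣ b - b') {x : ℤ} (hx : swap n a b x ≠ x) : swap n a' b' x = x := by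
  by_contra h
  rw [← ne_eq, swap_ne hab'] at h
  rw [swap_ne hab] at hx
  rcases h with h | h <;> rcases hx with hx | hx
  · exact h1 (dvd_tr (dvd_symm hx) h)
  · exact h3 (dvd_tr (dvd_symm hx) h)
  · exact h2 (dvd_tr (dvd_symm hx) h)
  · exact h4 (dvd_tr (dvd_symm hx) h)

theorem glue_comm_aux (hab : ¬ (n:ℤ) ∣ a - b) (hab' : ¬ (n:ℤ) ∣ a' - b') (h1 : ¬ (n:ℤ) ∣ a - a') (h2 : ¬ (n:ℤ) ∣ a - b') (h3 : ¬ (n:ℤ) ∣ b - a') (h4 : ¬ (n:ℤ) ∣ b - b') {f : ℤ → ℤ} (hf : Per n f) {x : ℤ} (hx : swap n a b x ≠ x ∨ swap n a b (f x) ≠ f x)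
   (hx' : swap n a' b' x = x) :
    glue n a b (glue n a' b' f) x = glue n a' b' (glue n a b f) x := by
  have hd {x} := @swap_disj n a b a' b' hab hab' h1 h2 h3 h4 x
  have ss := swap_swap hab
  have ss' := swap_swap hab'
  by_cases hxx : swap n a b x = x
  swap
  · rw [glue_moved hxx, glue_free hx', glue_moved hxx]
    rw [glue_moved hxx]
    apply hd
    rw [ss]; exact Ne.symm hxx
  have hy := hx.resolve_left (by simpa using hxx)
  clear hx
  have hk : swap n a b (swap n a b (f x)) ≠ swap n a b (f x) := by rw [ss]; exact Ne.symm hy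
  have hk' := hd hk
  have hy' := hd hy
  have e1 : glue n a' b' f x = f x := glue_free hx' hy'
  have e2 := glue_path (f := f) hxx hy
  rw [glue_path hxx (by rwa [e1]), e1]
  set y := f x with hyy
  set k := swap n a b y with hkk
  set m := f k with hm
  by_cases hm' : swap n a' b' m = m
  · have e3 : glue n a' b' f k = m := glue_free hk' hm'
    rw [e3]
    by_cases hmk : m = k
    · rw [if_pos hmk] at e2 ⊢
      rw [glue_free hx' (by rw [e2, hx']), e2]
    · rw [if_neg hmk] at e2 ⊢
      rw [glue_free hx' (by rw [e2, hm']), e2]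
  · have hmt : swap n a b m = m := by
      by_contra h; exact hm' (hd h)
    have hmk : m ≠ k := by rintro h; rw [h] at hm'; exact hm' hk'
    rw [if_neg hmk] at e2
    have e3 := glue_path (f := f) hk' hm'
    rw [← hm] at e3
    rw [glue_path hx' (by rwa [e2]), e2, e3]
    set u := swap n a' b' m with hu
    have huu : swap n a' b' u ≠ u := by rw [hu, ss']; exact Ne.symm hm'
    have hut : swap n a b u = u := by
      by_contra h; exact huu (hd h)
    have hw : swap n a b (f u) = f u := by
      by_contra hw
      rcases swap_tt hab hy hw with h | h
      · have := hf.sub h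
        rw [hyy, hf.inv, hf.inv] at this
        exact swap_tr hab' huu (y := x) (by rw [this]; simpa using dvd_symm h) hx'
      · rw [← hkk] at h
        have := hf.sub h
        rw [hf.inv, ← hm] at this
        exact hm' (swap_not_dvd hab' (by rw [← hu, this]; simpa using dvd_symm h))
    rw [glue_free hut hw]
    by_cases h : f u = u
    · simp [h]
    · rw [if_neg h, if_neg, if_neg h]
      intro h'
      apply hm'
      rw [hm, ← h', hf.inv]

theorem glue_comm (hab : ¬ (n:ℤ) ∣ a - b) (hab' : ¬ (n:ℤ) ∣ a' - b') (h1 : ¬ (n:ℤ) ∣ a - a') (h2 : ¬ (n:ℤ) ∣ a - b') (h3 : ¬ (n:ℤ) ∣ b - a') (h4 : ¬ (n:ℤ) ∣ b - b') {f : ℤ → ℤ} (hf : Per n f) :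
    glue n a b (glue n a' b' f) = glue n a' b' (glue n a b f) := by
  funext x
  have hd {x} := @swap_disj n a b a' b' hab hab' h1 h2 h3 h4 x
  have key := @glue_comm_aux n a b a' b' hab hab' h1 h2 h3 h4 f hf x
  have key' := @glue_comm_aux n a' b' a b hab' hab (mt dvd_symm h1) (mt dvd_symm h3)
    (mt dvd_symm h2) (mt dvd_symm h4) f hf x
  by_cases hx : swap n a b x = x
  swap
  · exact key (.inl hx) (hd hx)
  by_cases hx' : swap n a' b' x = x
  swap
  · exact (key' (.inl hx') hx).symm
  by_cases hy : swap n a b (f x) = f x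
  swap
  · exact key (.inr hy) hx'
  by_cases hy' : swap n a' b' (f x) = f x
  swap
  · exact (key' (.inr hy') hx).symm
  rw [glue_free hx, glue_free hx', glue_free hx', glue_free hx hy] <;>
  simp only [glue_free hx hy, glue_free hx' hy', hy, hy']

end

theorem swap_fst (a b : ℤ) : swap n a b a = b := by simp [swap]
theorem swap_snd {a b : ℤ} (hab : ¬ (n:ℤ) ∣ a - b) : swap n a b b = a := by
  rw [swap_symm hab, swap_fst]
theorem swap_off {a b x : ℤ} (h : ¬ (n:ℤ) ∣ x - a) (h' : ¬ (n:ℤ) ∣ x - b) : swap n a b x = x := by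
  simp [swap, h, h']
theorem swap_eq_iff {a b : ℤ} (hab : ¬ (n:ℤ) ∣ a - b) (x : ℤ) :
    swap n a b x = x ↔ (¬ (n:ℤ) ∣ x - a ∧ ¬ (n:ℤ) ∣ x - b) := by
  rw [← not_iff_not, ← ne_eq, swap_ne hab]; tauto

theorem glue_fst {a b : ℤ} (hab : ¬ (n:ℤ) ∣ a - b) (f) : glue n a b f a = b := by
  rw [glue_moved, swap_fst]; rw [swap_fst]; exact (ne_of_nd hab).symm
theorem glue_snd {a b : ℤ} (hab : ¬ (n:ℤ) ∣ a - b) (f) : glue n a b f b = a := by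
  rw [glue_moved, swap_snd hab]; rw [swap_snd hab]; exact (ne_of_nd hab)

theorem Per.ext' {f g : ℤ → ℤ} (hf : Per n f) (hg : Per n g) {c x : ℤ} (h : f c = g c)
    (hx : (n:ℤ) ∣ x - c) : f x = g x := by
  rw [hf.sub hx, hg.sub hx, h]

theorem Per.dvd {f : ℤ → ℤ} (hf : Per n f) {x y : ℤ} (h : (n:ℤ) ∣ x - f y) : (n:ℤ) ∣ f x - y := by
  rw [hf.sub h, hf.inv]; simpa using h

theorem glue_self {a b : ℤ} (hab : ¬ (n:ℤ) ∣ a - b) {f : ℤ → ℤ} (hf : Per n f) :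
    glue n a b (glue n a b f) = glue n a b f := by
  have hg := glue_per hab hf
  funext x
  by_cases hx : swap n a b x = x
  swap
  · rw [glue_moved hx, glue_moved hx]
  rw [glue_free hx]
  by_contra h
  apply h
  rw [← ne_eq, swap_ne hab] at h
  rw [swap_eq_iff hab] at hx
  rcases h with h | h
  · have := hg.sub h
    rw [hg.inv, glue_fst hab] at this
    refine absurd ?_ hx.2
    rw [this]; simpa using h
  · have := hg.sub h
    rw [hg.inv, glue_snd hab] at this
    refine absurd ?_ hx.1
    rw [this]; simpa using h

theorem weight_self (β : ℂ) (z : ℂˣ) {a b : ℤ} (hab : ¬ (n:ℤ) ∣ a - b) (f : ℤ → ℤ) :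
    weight n β z a b (glue n a b f) = β := by
  simp [weight, glue_fst hab]

section
variable {a b c : ℤ} {g : ℤ → ℤ}


theorem glue3_fst (hab : ¬ (n:ℤ) ∣ a - b) (hbc : ¬ (n:ℤ) ∣ b - c) (hac : ¬ (n:ℤ) ∣ a - c) (hg : Per n g) (h0 : g a = b) : glue n b c g a = if g c = c then a else g c := by
  have h1 : swap n b c a = a := swap_off hab hac
  rw [glue_path h1, h0, swap_fst]
  rw [h0, swap_fst]; exact (ne_of_nd hbc).symm

theorem glue3 (hab : ¬ (n:ℤ) ∣ a - b) (hbc : ¬ (n:ℤ) ∣ b - c) (hac : ¬ (n:ℤ) ∣ a - c) (hg : Per n g) (h0 : g a = b) : glue n a b (glue n b c g) c = g c := by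
  have h1 : swap n a b c = c := swap_off (mt dvd_symm hac) (mt dvd_symm hbc)
  have h2 : glue n b c g c = b := glue_snd hbc g
  rw [glue_path h1, h2, swap_snd hab, glue3_fst hab hbc hac hg h0]
  · by_cases h : g c = c
    · simp [h]
    · rw [if_neg h, if_neg]
      intro h'; apply ne_of_nd hbc; rw [← h0, ← h', hg.inv]
  · rw [h2, swap_snd hab]; exact ne_of_nd hab

theorem weight3 (hab : ¬ (n:ℤ) ∣ a - b) (hbc : ¬ (n:ℤ) ∣ b - c) (hac : ¬ (n:ℤ) ∣ a - c) (hg : Per n g) (h0 : g a = b) (β : ℂ) (z : ℂˣ) :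
    weight n β z a b (glue n b c g) * weight n β z b c g = 1 := by
  have h0' : g b = a := by rw [← h0, hg.inv]
  have h1 := glue3_fst hab hbc hac hg h0
  have h2 : glue n b c g b = c := glue_fst hbc g
  have nab := ne_of_nd hab
  have nac := ne_of_nd hac
  have nbc := ne_of_nd hbc
  unfold weight
  rw [h0', h1, h2]
  by_cases h : g c = c
  · simp only [h, if_true]
    rw [if_neg nab, if_neg hab, if_neg (by tauto), if_neg nac, if_neg hac, if_neg (by tauto),
      if_neg nab, ← zpow_add₀ (by simp)]
    simp
  · have h3 : ¬ (n:ℤ) ∣ g c - b := by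
      intro h3
      have := hg.sub h3
      rw [hg.inv, h0'] at this
      apply hac; rw [this]; simpa using dvd_symm h3
    have h4 : ¬ g c = b := by intro h; simp [h] at h3
    have h5 : ¬ g c = a := by intro h; apply nbc; rw [← h0, ← h, hg.inv]
    simp [h, h3, h4, h5, nac, hac, nab, nbc.symm]
end

theorem glue_three {a b c : ℤ} (hab : ¬ (n:ℤ) ∣ a - b) (hbc : ¬ (n:ℤ) ∣ b - c)
    (hac : ¬ (n:ℤ) ∣ a - c) {f : ℤ → ℤ} (hf : Per n f) :
    glue n a b (glue n b c (glue n a b f)) = glue n a b f := by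
  set g := glue n a b f with hgd
  have hg : Per n g := glue_per hab hf
  have h0 : g a = b := glue_fst hab f
  have key := glue3 hab hbc hac hg h0
  have hg2 := glue_per hbc hg
  have hg3 := glue_per hab hg2
  funext x
  by_cases hx : swap n a b x = x
  swap
  · rw [glue_moved hx, hgd, glue_moved hx]
  by_cases hc : (n:ℤ) ∣ x - c
  · exact hg3.ext' hg key hc
  by_cases hy : (n:ℤ) ∣ g x - c
  · have e := hg3.ext' hg key hy
    rw [hg.inv] at e
    rw [← e, hg3.inv, e]
  have hx0 := hx
  rw [swap_eq_iff hab] at hx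
  have hya : ¬ (n:ℤ) ∣ g x - a := by
    intro h
    have := hg.sub h
    rw [hg.inv, h0] at this
    apply hx.2; rw [this]; simpa using h
  have hyb : ¬ (n:ℤ) ∣ g x - b := by
    intro h
    have := hg.sub h
    rw [hg.inv, ← h0, hg.inv] at this
    apply hx.1; rw [this]; simpa [h0] using h
  have e : glue n b c g x = g x := glue_free (swap_off hx.2 hc) (swap_off hyb hy)
  rw [glue_free hx0, e]
  rw [e]; exact swap_off hya hyb

theorem weight_symm (β : ℂ) (z : ℂˣ) {a b : ℤ} (hab : ¬ (n:ℤ) ∣ a - b) {f : ℤ → ℤ} (hf : Per n f) :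
    weight n β z a b f = weight n β z b a f := by
  have e1 : f a = b ↔ f b = a := ⟨fun h => by rw [← h, hf.inv], fun h => by rw [← h, hf.inv]⟩
  have e2 : (n:ℤ) ∣ f a - b ↔ (n:ℤ) ∣ f b - a :=
    ⟨fun h => by have := hf.dvd (dvd_symm h); exact this, fun h => hf.dvd (dvd_symm h)⟩
  unfold weight
  simp only [e1, e2]
  by_cases h1 : f a = a <;> by_cases h2 : f b = b <;> simp [h1, h2]

theorem weight_shift (β : ℂ) (z : ℂˣ) (hn : n ≠ 0) (a b k : ℤ) {f : ℤ → ℤ} (hf : Per n f) :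
    weight n β z (a + k * n) (b + k * n) f = weight n β z a b f := by
  have hc (x : ℤ) : cell n (x + k * n) = cell n x + k := by
    unfold cell
    rw [show x + k * n - 1 = x - 1 + k * n by ring, Int.add_mul_ediv_right _ _ (by exact_mod_cast hn)]
  unfold weight
  simp only [hf.mul, hc, add_left_inj, add_sub_add_right_eq_sub]

theorem swap_shift (a b k x : ℤ) : swap n (a + k * n) (b + k * n) x = swap n a b x := by
  have e (c : ℤ) : (n:ℤ) ∣ x - (c + k * n) ↔ (n:ℤ) ∣ x - c := by
    rw [show x - (c + k * n) = x - c - k * n by ring]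
    exact dvd_sub_left (Dvd.intro_left _ rfl)
  unfold swap; simp only [e, add_sub_add_right_eq_sub]

theorem glue_shift (a b k : ℤ) (f : ℤ → ℤ) : glue n (a + k * n) (b + k * n) f = glue n a b f := by
  funext x; unfold glue; simp only [swap_shift]

theorem glue_symm {a b : ℤ} (hab : ¬ (n:ℤ) ∣ a - b) (f : ℤ → ℤ) : glue n a b f = glue n b a f := by
  funext x; unfold glue; simp only [swap_symm hab]

section
variable {a b a' b' : ℤ} (β : ℂ) (z : ℂˣ) {f : ℤ → ℤ}


theorem weight_comm_free (hab : ¬ (n:ℤ) ∣ a - b) (hab' : ¬ (n:ℤ) ∣ a' - b') (h1 : ¬ (n:ℤ) ∣ a - a') (h2 : ¬ (n:ℤ) ∣ a - b') (h3 : ¬ (n:ℤ) ∣ b - a') (h4 : ¬ (n:ℤ) ∣ b - b') (hf : Per n f) (e1 : ¬ (n:ℤ) ∣ f a' - a) (e2 : ¬ (n:ℤ) ∣ f a' - b)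
    (e3 : ¬ (n:ℤ) ∣ f b' - a) (e4 : ¬ (n:ℤ) ∣ f b' - b) :
    weight n β z a' b' (glue n a b f) = weight n β z a' b' f := by
  have ha : glue n a b f a' = f a' :=
    glue_free (swap_off (mt dvd_symm h1) (mt dvd_symm h3)) (swap_off e1 e2)
  have hb : glue n a b f b' = f b' :=
    glue_free (swap_off (mt dvd_symm h2) (mt dvd_symm h4)) (swap_off e3 e4)
  simp [weight, ha, hb]

theorem weight_comm_link (hab : ¬ (n:ℤ) ∣ a - b) (hab' : ¬ (n:ℤ) ∣ a' - b') (h1 : ¬ (n:ℤ) ∣ a - a') (h2 : ¬ (n:ℤ) ∣ a - b') (h3 : ¬ (n:ℤ) ∣ b - a') (h4 : ¬ (n:ℤ) ∣ b - b') (hf : Per n f) (e : f a' = a) :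
    weight n β z a b (glue n a' b' f) * weight n β z a' b' f =
    weight n β z a' b' (glue n a b f) * weight n β z a b f := by
  have e' : f a = a' := by rw [← e, hf.inv]
  have h1' := mt dvd_symm h1
  have h2' := mt dvd_symm h2
  have h3' := mt dvd_symm h3
  have h4' := mt dvd_symm h4
  have nab := ne_of_nd hab
  have nab' := ne_of_nd hab'
  have n1 := ne_of_nd h1
  have n2 := ne_of_nd h2
  have n3 := ne_of_nd h3
  have n4 := ne_of_nd h4
  have ga : glue n a b f a' = if f b = b then a' else f b := by
    rw [glue_path (swap_off h1' h3'), e, swap_fst]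
    rw [e, swap_fst]; exact nab.symm
  have ga' : glue n a' b' f a = if f b' = b' then a else f b' := by
    rw [glue_path (swap_off h1 h2), e', swap_fst]
    rw [e', swap_fst]; exact nab'.symm
  have fba : ¬ (n:ℤ) ∣ f b - a := by
    intro h; have := hf.dvd (dvd_symm h); rw [e'] at this; exact h3' this
  have fba' : ¬ (n:ℤ) ∣ f b - a' := by
    intro h; have := hf.dvd (dvd_symm h); rw [e] at this; exact hab this
  have fb'a : ¬ (n:ℤ) ∣ f b' - a := by
    intro h; have := hf.dvd (dvd_symm h); rw [e'] at this; exact hab' this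
  have fb'a' : ¬ (n:ℤ) ∣ f b' - a' := by
    intro h; have := hf.dvd (dvd_symm h); rw [e] at this; exact h2 this
  have nn {x y : ℤ} (h : ¬ (n:ℤ) ∣ x - y) : x ≠ y := ne_of_nd h
  by_cases hbb : (n:ℤ) ∣ f b - b'
  · have q := hf.sub (dvd_symm hbb)
    rw [hf.inv] at q
    have r := hf.sub hbb
    rw [hf.inv] at r
    have s1 : f b ≠ b := by intro h; rw [h] at hbb; exact h4 hbb
    have s2 : f b' ≠ b' := by
      intro h; apply h4; rw [r, h]; simpa using hbb
    have w1 : weight n β z a b f = 1 := by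
      simp [weight, e', h3', n3.symm, n1.symm, s1]
    have w2 : weight n β z a' b' f = 1 := by
      simp [weight, e, h2, n2, n1, s2]
    rw [w1, w2]
    unfold weight
    rw [ga, ga', if_neg s1, if_neg s2]
    have d1 : (n:ℤ) ∣ f b' - b := by rw [q]; simpa using dvd_symm hbb
    by_cases hh : f b = b'
    · have : f b' = b := by rw [← hh, hf.inv]
      simp [hh, this]
    · have : f b' ≠ b := by rintro h; apply hh; rw [← h, hf.inv]
      simp [hh, this, d1, hbb]
  · have hbb' : ¬ (n:ℤ) ∣ f b' - b := by
      intro h; exact hbb (hf.dvd (dvd_symm h))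
    have gb : glue n a b f b' = f b' := glue_free (swap_off h2' h4') (swap_off fb'a hbb')
    have gb' : glue n a' b' f b = f b := glue_free (swap_off h3 h4) (swap_off fba' hbb)
    have m1 := nn fba
    have m2 := nn fba'
    have m3 := nn fb'a
    have m4 := nn fb'a'
    have m5 := nn hbb
    have m6 := nn hbb'
    have z0 : (z : ℂ) ≠ 0 := by simp
    unfold weight
    rw [ga, ga', gb, gb', e, e']
    by_cases hb : f b = b <;> by_cases hb' : f b' = b' <;>
      simp only [hb, hb', if_true, if_false, and_true, and_false, true_and, h1, h2, h3, h4,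
        h1', h2', h3', h4', hab, hab', nab, nab', n1, n2, n3, n4, n1.symm, n2.symm, n3.symm, n4.symm,
        m1, m2, m3, m4, m5, m6, hbb, hbb', fba, fba', fb'a, fb'a', mul_zero, zero_mul, mul_one, one_mul,
        ← zpow_add₀ z0, sub_add_sub_cancel, sub_add_sub_cancel']
end
section
variable {a b a' b' : ℤ} (β : ℂ) (z : ℂˣ) {f : ℤ → ℤ}


theorem weight_comm_a (hab : ¬ (n:ℤ) ∣ a - b) (hab' : ¬ (n:ℤ) ∣ a' - b') (h1 : ¬ (n:ℤ) ∣ a - a') (h2 : ¬ (n:ℤ) ∣ a - b') (h3 : ¬ (n:ℤ) ∣ b - a') (h4 : ¬ (n:ℤ) ∣ b - b') (hn : n ≠ 0) (hf : Per n f) (e : (n:ℤ) ∣ f a' - a) :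
    weight n β z a b (glue n a' b' f) * weight n β z a' b' f =
    weight n β z a' b' (glue n a b f) * weight n β z a b f := by
  obtain ⟨k, hk⟩ := e
  have hs {x y : ℤ} : (n:ℤ) ∣ (x + k * n) - y ↔ (n:ℤ) ∣ x - y := by
    rw [show x + k * n - y = x - y + k * n by ring]
    exact dvd_add_left (Dvd.intro_left _ rfl)
  have := weight_comm_link β z (a := a + k * n) (b := b + k * n) (a' := a') (b' := b')
    (by rwa [add_sub_add_right_eq_sub]) hab' (by rwa [hs]) (by rwa [hs]) (by rwa [hs]) (by rwa [hs])
    hf (by linarith)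
  rwa [weight_shift β z hn _ _ _ hf, weight_shift β z hn _ _ _ (glue_per hab' hf), glue_shift] at this

theorem weight_comm_ab (hab : ¬ (n:ℤ) ∣ a - b) (hab' : ¬ (n:ℤ) ∣ a' - b') (h1 : ¬ (n:ℤ) ∣ a - a') (h2 : ¬ (n:ℤ) ∣ a - b') (h3 : ¬ (n:ℤ) ∣ b - a') (h4 : ¬ (n:ℤ) ∣ b - b') (hn : n ≠ 0) (hf : Per n f) (e : (n:ℤ) ∣ f a' - a ∨ (n:ℤ) ∣ f a' - b) :
    weight n β z a b (glue n a' b' f) * weight n β z a' b' f =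
    weight n β z a' b' (glue n a b f) * weight n β z a b f := by
  rcases e with e | e
  · exact weight_comm_a β z hab hab' h1 h2 h3 h4 hn hf e
  · have hba := mt dvd_symm hab
    have := weight_comm_a β z hba hab' h3 h4 h1 h2 hn hf e
    rwa [weight_symm β z hba hf, weight_symm β z hba (glue_per hab' hf), glue_symm hba] at this

theorem weight_comm (hab : ¬ (n:ℤ) ∣ a - b) (hab' : ¬ (n:ℤ) ∣ a' - b') (h1 : ¬ (n:ℤ) ∣ a - a') (h2 : ¬ (n:ℤ) ∣ a - b') (h3 : ¬ (n:ℤ) ∣ b - a') (h4 : ¬ (n:ℤ) ∣ b - b') (hn : n ≠ 0) (hf : Per n f) :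
    weight n β z a b (glue n a' b' f) * weight n β z a' b' f =
    weight n β z a' b' (glue n a b f) * weight n β z a b f := by
  by_cases e : (n:ℤ) ∣ f a' - a ∨ (n:ℤ) ∣ f a' - b
  · exact weight_comm_ab β z hab hab' h1 h2 h3 h4 hn hf e
  by_cases e' : (n:ℤ) ∣ f b' - a ∨ (n:ℤ) ∣ f b' - b
  · have hba := mt dvd_symm hab'
    have := weight_comm_ab β z hab hba h2 h1 h4 h3 hn hf e'
    rwa [weight_symm β z hba hf, weight_symm β z hba (glue_per hab hf), glue_symm hba] at this
  push Not at e e'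
  rw [weight_comm_free β z hab hab' h1 h2 h3 h4 hf e.1 e.2 e'.1 e'.2,
    weight_comm_free β z hab' hab (mt dvd_symm h1) (mt dvd_symm h3) (mt dvd_symm h2)
      (mt dvd_symm h4) hf (fun h => e.1 (hf.dvd (dvd_symm h))) (fun h => e'.1 (hf.dvd (dvd_symm h)))
      (fun h => e.2 (hf.dvd (dvd_symm h))) (fun h => e'.2 (hf.dvd (dvd_symm h)))]
  ring
end

/-- A link state on `n ≥ 1` nodes with `d` defects. The node `i` is joined by an arc to `pair i`, and
it carries a defect if `pair i = i`. Below an arc there is neither a defect nor the end of an arc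
that leaves the region below the first one. -/
structure LinkState (n d : ℕ) where
  pair : ℤ → ℤ
  pair_pair : ∀ i, pair (pair i) = i
  pair_add : ∀ i, pair (i + n) = pair i + n
  planar : ∀ i j, i < j → j < pair i → pair j ≠ j ∧ i < pair j ∧ pair j < pair i
  card_defects : ((Finset.Icc (1 : ℤ) n).filter fun i => pair i = i).card = d

theorem glue_planar (hn : 2 ≤ n) (j : ℤ) {f : ℤ → ℤ} (hf : Per n f)
    (hp : ∀ i j, i < j → j < f i → f j ≠ j ∧ i < f j ∧ f j < f i) (x y : ℤ) (h1 : x < y)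
    (h2 : y < glue n j (j+1) f x) :
    glue n j (j+1) f y ≠ y ∧ x < glue n j (j+1) f y ∧ glue n j (j+1) f y < glue n j (j+1) f x := by
  have hab : ¬ (n:ℤ) ∣ j - (j+1) := by
    intro h
    have h : (n:ℤ) ∣ 1 := by simpa using h
    have := Int.le_of_dvd one_pos h
    omega
  have sw (i : ℤ) : swap n j (j+1) i = i ∨ swap n j (j+1) i = i + 1 ∨ swap n j (j+1) i = i - 1 := by
    unfold swap; split_ifs <;> omega
  have ss := swap_swap hab
  have sd {i : ℤ} := swap_not_dvd hab (x := i)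
  have st {x y : ℤ} := swap_tt hab (x := x) (y := y)
  have str {x y : ℤ} := swap_tr hab (x := x) (y := y)
  by_cases hx : swap n j (j+1) x = x
  swap
  · rw [glue_moved hx] at h2
    have := sw x
    omega
  -- the open interval is stable under both matchings
  have key : ∃ E : ℤ → Prop, (∀ i, E i → swap n j (j+1) i ≠ i ∧ swap n j (j+1) (f i) = f i ∧ ¬ (x < f i ∧ f i < glue n j (j+1) f x)) ∧
    (∀ i, x < i → i < glue n j (j+1) f x → swap n j (j+1) i ≠ i →
      x < swap n j (j+1) i ∧ swap n j (j+1) i < glue n j (j+1) f x) ∧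
    (∀ i, x < i → i < glue n j (j+1) f x → ¬ E i → f i ≠ i ∧ x < f i ∧ f i < glue n j (j+1) f x) ∧
    (∀ i, E i → E (swap n j (j+1) i)) := by
    have hq := glue_per hab hf
    have qx : glue n j (j+1) f x ≠ x := by omega
    have sq : swap n j (j+1) (glue n j (j+1) f x) = glue n j (j+1) f x := by
      by_contra h
      have h' := hq.inv x
      rw [glue_moved h] at h'
      rw [← h', ss] at hx
      exact qx (by rw [hx, h'])
    have k2 : ∀ i, x < i → i < glue n j (j+1) f x → swap n j (j+1) i ≠ i →
        x < swap n j (j+1) i ∧ swap n j (j+1) i < glue n j (j+1) f x := by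
      intro i hi1 hi2 hi
      have e1 : swap n j (j+1) i ≠ x := by
        intro h; rw [← h, ss] at hx; omega
      have e2 : swap n j (j+1) i ≠ glue n j (j+1) f x := by
        intro h; rw [← h, ss] at sq; omega
      have := sw i
      omega
    by_cases ha : swap n j (j+1) (f x) = f x
    · refine ⟨fun _ => False, by simp, k2, ?_, by simp⟩
      rw [glue_free hx ha]
      exact fun i hi1 hi2 _ => hp x i hi1 hi2
    have eq := glue_path (f := f) hx ha
    have hfb : f (swap n j (j+1) (f x)) ≠ swap n j (j+1) (f x) := by
      intro h; rw [if_pos h] at eq; omega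
    rw [if_neg hfb] at eq
    have hfx := hf.inv
    refine ⟨fun i => i = f x ∨ i = swap n j (j+1) (f x), ?_, k2, ?_, ?_⟩
    · rintro i (rfl | rfl)
      · exact ⟨ha, by rw [hfx, hx], by rw [hfx]; omega⟩
      · exact ⟨by rw [ss]; exact Ne.symm ha, by rw [← eq, sq], by rw [← eq]; omega⟩
    · have hbx : swap n j (j+1) (f x) ≠ x := by
        intro h; have h' := ss (f x); rw [h, hx] at h'; exact ha (by rw [← h']; exact hx)
      have hax : f x ≠ x := by intro h; rw [h] at ha; exact ha hx
      have swa := sw (f x)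
      intro i hi1 hi2 hi
      rw [eq] at hi2 ⊢
      have i1 := hfx i
      have i2 := hfx x
      generalize swap n j (j+1) (f x) = b at *
      generalize hA : f x = a at *
      have i3 := hfx b
      generalize hQ : f b = q at *
      have hqa : q ≠ a := by rintro rfl; omega
      have hne : f i ≠ q ∧ f i ≠ x ∧ (i ≠ q → f i ≠ b) ∧ (i ≠ x → f i ≠ a) := by
        refine ⟨?_, ?_, ?_, ?_⟩
        · intro h; rw [h] at i1; omega
        · intro h; rw [h] at i1; omega
        · intro h h'; rw [h'] at i1; omega
        · intro h h'; rw [h'] at i1; omega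
      have p1 := hp x i
      have p2 := hp b i
      have p3 := hp q a
      have p4 := hp a b
      have p5 := hp x b
      have p6 := hp q (f i)
      have p7 := hp b a
      have p8 := hp a (f i)
      rw [hA] at p1 p5
      rw [hQ] at p2 p7
      rw [i3] at p3 p6
      rw [i2] at p4 p8
      rw [i1] at p6 p8
      rw [i2] at p3 p7
      rw [hQ] at p4 p5
      by_cases hfi : f i = i <;> omega
    · rintro i (rfl | rfl)
      · exact .inr rfl
      · exact .inl (ss _)
  obtain ⟨E, k1, k2, k3, k4⟩ := key
  generalize hq : glue n j (j+1) f x = q at *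
  by_cases hy : swap n j (j+1) y = y
  swap
  · rw [glue_moved hy]
    exact ⟨hy, k2 y h1 h2 hy⟩
  have ey : ¬ E y := fun h => (k1 y h).1 hy
  obtain ⟨a1, a2, a3⟩ := k3 y h1 h2 ey
  by_cases hz : swap n j (j+1) (f y) = f y
  · rw [glue_free hy hz]; exact ⟨a1, a2, a3⟩
  have b := k2 _ a2 a3 hz
  have ez : ¬ E (swap n j (j+1) (f y)) := by
    intro h
    have := k4 _ h
    rw [ss] at this
    have := (k1 _ this).2.2
    rw [hf.inv] at this
    exact this ⟨h1, h2⟩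
  obtain ⟨c1, c2, c3⟩ := k3 _ b.1 b.2 ez
  rw [glue_path hy hz, if_neg c1]
  refine ⟨?_, c2, c3⟩
  intro h
  apply hz
  have h' := hf.inv (swap n j (j + 1) (f y))
  rw [h] at h'
  exact h'.symm


theorem nd_succ (hn : 2 ≤ n) (j : ℤ) : ¬ (n:ℤ) ∣ j - (j+1) := by
  intro h
  have h : (n:ℤ) ∣ 1 := by simpa using h
  have := Int.le_of_dvd one_pos h
  omega

theorem glue_fixed {a b : ℤ} (hab : ¬ (n:ℤ) ∣ a - b) {f : ℤ → ℤ} (hf : Per n f) (x : ℤ) :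
    glue n a b f x = x ↔ swap n a b x = x ∧
      (f x = x ∨ swap n a b (f x) ≠ f x ∧ f (swap n a b (f x)) = swap n a b (f x)) := by
  by_cases hx : swap n a b x = x
  swap
  · rw [glue_moved hx]; tauto
  by_cases hy : swap n a b (f x) = f x
  · rw [glue_free hx hy]; tauto
  rw [glue_path hx hy]
  have : f x ≠ x := by intro h; rw [h] at hy; exact hy hx
  split_ifs with h
  · tauto
  · simp only [hx, hy, h, this, or_false, and_false, iff_false, ne_eq, not_false_eq_true]
    intro h'
    apply hy
    have e := hf.inv (swap n a b (f x))
    rw [h'] at e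
    exact e.symm

noncomputable def defects (n : ℕ) (f : ℤ → ℤ) : Finset ℤ := (Finset.Icc (1 : ℤ) n).filter fun i => f i = i

theorem exists_rep (hn : 0 < n) (x : ℤ) : ∃ y ∈ Finset.Icc (1:ℤ) n, (n:ℤ) ∣ y - x := by
  have hn' : (0:ℤ) < n := by exact_mod_cast hn
  refine ⟨(x - 1) % n + 1, ?_, ?_⟩
  · have := Int.emod_nonneg (x - 1) hn'.ne'
    have := Int.emod_lt_of_pos (x - 1) hn'
    simp; omega
  · have := Int.emod_add_mul_ediv (x - 1) n
    exact ⟨-((x-1)/n), by linarith⟩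

theorem rep_unique {x y : ℤ} (hx : x ∈ Finset.Icc (1:ℤ) n) (hy : y ∈ Finset.Icc (1:ℤ) n)
    (h : (n:ℤ) ∣ x - y) : x = y := by
  simp only [Finset.mem_Icc] at hx hy
  have := Int.eq_zero_of_abs_lt_dvd h (by rw [abs_lt]; omega)
  omega

theorem card_glue_aux (hn : 0 < n) {a b : ℤ} (hab : ¬ (n:ℤ) ∣ a - b) {f : ℤ → ℤ} (hf : Per n f)
    (ha : f a = a) (hb : f b ≠ b) :
    (defects n (glue n a b f)).card = (defects n f).card := by
  obtain ⟨p, hp, hpa⟩ := exists_rep hn a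
  obtain ⟨q, hq, hqb⟩ := exists_rep hn (f b)
  have hfq := hf.dvd hqb
  have fp : f p = p := by rw [hf.sub hpa, ha]; ring
  have hqa : ¬ (n:ℤ) ∣ q - a := by
    intro h
    have := hf.sub h
    rw [ha] at this
    have h2 := hfq
    rw [this] at h2
    apply hab
    have := dvd_sub h2 h
    rwa [show a + (q - a) - b - (q - a) = a - b by ring] at this
  have hqb' : ¬ (n:ℤ) ∣ q - b := by
    intro h
    exact hb (hf.fix (dvd_tr (dvd_symm hqb) h))
  have fq : f q ≠ q := by
    intro h; rw [h] at hfq; exact hqb' hfq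
  have : defects n (glue n a b f) = insert q ((defects n f).erase p) := by
    ext x
    simp only [defects, Finset.mem_filter, Finset.mem_insert, Finset.mem_erase, glue_fixed hab hf]
    rw [swap_eq_iff hab]
    constructor
    · rintro ⟨hx, ⟨h1, h2⟩, h | ⟨h, h'⟩⟩
      · right
        exact ⟨by rintro rfl; exact h1 hpa, hx, h⟩
      · left
        rw [swap_ne hab] at h
        rcases h with h | h
        · have := hf.sub h
          rw [hf.inv, ha] at this
          exact absurd (by rw [this]; simpa using h) h1
        · have := hf.dvd (dvd_symm h)
          exact rep_unique hx hq (dvd_tr (dvd_symm this) (dvd_symm hqb))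
    · rintro (rfl | ⟨h1, h2, h3⟩)
      · refine ⟨hq, ⟨hqa, hqb'⟩, .inr ?_⟩
        have : swap n a b (f x) = f x + (a - b) := by
          rw [swap_symm hab]; simp [swap, hfq]
        rw [this]
        refine ⟨by have := ne_of_nd hab; omega, ?_⟩
        apply hf.fix
        have hd : (n:ℤ) ∣ f x + (a - b) - a := by
          rwa [show f x + (a - b) - a = f x - b by ring]
        rw [hf.sub hd, ha]; simp
      · refine ⟨h2, ⟨?_, ?_⟩, .inl h3⟩
        · intro h; exact h1 (rep_unique h2 hp (dvd_tr h (dvd_symm hpa)))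
        · intro h
          have := hf.sub (dvd_symm h)
          rw [h3] at this
          exact hb (by linarith)
  rw [this, Finset.card_insert_of_notMem, Finset.card_erase_of_mem]
  · have : 0 < (defects n f).card := Finset.card_pos.2 ⟨p, by simp only [defects, Finset.mem_filter]; exact ⟨hp, fp⟩⟩
    omega
  · simp [defects, fp]; simpa using hp
  · simp [defects, fq]

theorem card_glue (hn : 0 < n) {a b : ℤ} (hab : ¬ (n:ℤ) ∣ a - b) {f : ℤ → ℤ} (hf : Per n f)
    (h : ¬ (f a = a ∧ f b = b)) :
    (defects n (glue n a b f)).card = (defects n f).card := by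
  by_cases ha : f a = a
  · exact card_glue_aux hn hab hf ha (fun hb => h ⟨ha, hb⟩)
  by_cases hb : f b = b
  · rw [glue_symm hab]; exact card_glue_aux hn (mt dvd_symm hab) hf hb ha
  congr 1
  ext x
  simp only [defects, Finset.mem_filter, glue_fixed hab hf, swap_eq_iff hab]
  have h1 {y} (h : (n:ℤ) ∣ y - a) : f y ≠ y := by rw [hf.sub h]; omega
  have h2 {y} (h : (n:ℤ) ∣ y - b) : f y ≠ y := by rw [hf.sub h]; omega
  have h3 {y} (h : swap n a b y ≠ y) : f y ≠ y := by
    rw [swap_ne hab] at h; exact h.elim h1 h2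
  have h4 : ¬ (swap n a b (f x) ≠ f x ∧ f (swap n a b (f x)) = swap n a b (f x)) := by
    rintro ⟨h, h'⟩
    exact h3 (by rw [swap_swap hab]; exact Ne.symm h) h'
  constructor
  · tauto
  · rintro ⟨hx, hxx⟩
    exact ⟨hx, ⟨fun h => h1 h hxx, fun h => h2 h hxx⟩, .inl hxx⟩

namespace LinkState
variable {d : ℕ}
theorem per (v : LinkState n d) : Per n v.pair := ⟨v.pair_pair, v.pair_add⟩

/-- The link state read off from `e_j` with `v` on top, if no two defects are attached. -/
def act (v : LinkState n d) (hn : 2 ≤ n) (j : ℤ) (h : ¬ (v.pair j = j ∧ v.pair (j+1) = j+1)) :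
    LinkState n d where
  pair := glue n j (j+1) v.pair
  pair_pair := (glue_per (nd_succ hn j) v.per).inv
  pair_add := (glue_per (nd_succ hn j) v.per).per
  planar := glue_planar hn j v.per v.planar
  card_defects := (card_glue (by omega) (nd_succ hn j) v.per h).trans v.card_defects

/-- The number of arcs that cross the boundary condition: every such arc has exactly one lift whose
left end is in `{1, …, n}` and whose right end is larger than `n`. -/
noncomputable def crossings (v : LinkState n d) : ℕ :=
  ((Finset.Icc (1 : ℤ) n).filter fun i => (n : ℤ) < v.pair i).card

/-- The parity `σ_v`: `0` if an odd number of arcs crosses the boundary condition, `1` if this number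
is even. -/
noncomputable def parity (v : LinkState n d) : ℕ := if Odd v.crossings then 0 else 1

theorem pair_injective : Function.Injective (LinkState.pair : LinkState n d → ℤ → ℤ) := by
  rintro ⟨⟩ ⟨⟩ h; congr
end LinkState

/-- The underlying vector space of the standard module `W_{n,d,z}`: the free complex vector space on
the link states. The action of the algebra depends on `z`. -/
def StdModule (n d : ℕ) (z : ℂˣ) : Type := LinkState n d →₀ ℂ

variable {d : ℕ}
noncomputable section
instance (z : ℂˣ) : AddCommGroup (StdModule n d z) := inferInstanceAs (AddCommGroup (LinkState n d →₀ ℂ))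
instance (z : ℂˣ) : Module ℂ (StdModule n d z) := inferInstanceAs (Module ℂ (LinkState n d →₀ ℂ))

namespace StdModule

/-- The basis of link states. -/
def basis (n d : ℕ) (z : ℂˣ) : Module.Basis (LinkState n d) ℂ (StdModule n d z) := Finsupp.basisSingleOne

/-- The action of the generator `e_j`, which joins the nodes `j` and `j + 1`, `j` taken modulo `n`. -/
def e (β : ℂ) (z : ℂˣ) (hn : 2 ≤ n) (j : ℤ) : StdModule n d z →ₗ[ℂ] StdModule n d z :=
  (basis n d z).constr ℂ fun v =>
    if h : v.pair j = j ∧ v.pair (j + 1) = j + 1 then 0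
    else weight n β z j (j + 1) v.pair • basis n d z (v.act hn j h)

/-- Auxiliary: the inclusion into the free vector space on all maps `ℤ → ℤ`. -/
def emb (z : ℂˣ) : StdModule n d z →ₗ[ℂ] ((ℤ → ℤ) →₀ ℂ) := (basis n d z).constr ℂ fun v => Finsupp.single v.pair 1

theorem emb_inj (z : ℂˣ) : Function.Injective (emb (n := n) (d := d) z) := by
  have : emb (n := n) (d := d) z = Finsupp.lmapDomain ℂ ℂ LinkState.pair := by
    apply (basis n d z).ext
    intro v
    rw [emb, Module.Basis.constr_basis]
    simp [basis]
    exact (Finsupp.mapDomain_single).symm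
  rw [this]
  exact Finsupp.mapDomain_injective LinkState.pair_injective

/-- Auxiliary: the operator `e` on the free vector space on all maps `ℤ → ℤ`. -/
def raw (n : ℕ) (β : ℂ) (z : ℂˣ) (a b : ℤ) : ((ℤ → ℤ) →₀ ℂ) →ₗ[ℂ] ((ℤ → ℤ) →₀ ℂ) :=
  Finsupp.linearCombination ℂ fun f => Finsupp.single (glue n a b f) (weight n β z a b f)

theorem raw_single (β c : ℂ) (z : ℂˣ) (a b : ℤ) (f : ℤ → ℤ) :
    raw n β z a b (Finsupp.single f c) = Finsupp.single (glue n a b f) (weight n β z a b f * c) := by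
  simp [raw, mul_comm]

theorem emb_e (β : ℂ) (z : ℂˣ) (hn : 2 ≤ n) (j : ℤ) (x : StdModule n d z) :
    emb z (e β z hn j x) = raw n β z j (j+1) (emb z x) := by
  suffices emb z ∘ₗ e β z hn j = raw n β z j (j+1) ∘ₗ emb z by
    exact LinearMap.congr_fun this x
  apply (basis n d z).ext
  intro v
  simp only [LinearMap.comp_apply, e, emb, Module.Basis.constr_basis, raw_single]
  split_ifs with h
  · have : weight n β z j (j+1) v.pair = 0 := by
      unfold weight
      rw [h.1, if_neg (by omega), if_neg (nd_succ hn j), if_pos ⟨rfl, h.2⟩]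
    simp [this]
  · simp only [map_smul, Module.Basis.constr_basis, LinkState.act, mul_one, Finsupp.smul_single, smul_eq_mul]

theorem ext_emb {z : ℂˣ} {A B : StdModule n d z →ₗ[ℂ] StdModule n d z}
    (h : ∀ v, emb z (A (basis n d z v)) = emb z (B (basis n d z v))) : A = B :=
  (basis n d z).ext fun v => emb_inj z (h v)

theorem emb_basis (z : ℂˣ) (v : LinkState n d) : emb z (basis n d z v) = Finsupp.single v.pair 1 := by
  rw [emb, Module.Basis.constr_basis]

variable (β : ℂ) (z : ℂˣ) (hn : 2 ≤ n)
theorem e_sq (j : ℤ) : (e β z hn j * e β z hn j : Module.End ℂ (StdModule n d z)) = β • e β z hn j := by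
  apply ext_emb; intro v
  have hab := nd_succ hn j
  simp only [Module.End.mul_apply, LinearMap.smul_apply, map_smul, emb_e, emb_basis, raw_single, glue_self hab v.per,
    weight_self β z hab, Finsupp.smul_single, smul_eq_mul]

theorem nd_of {a b : ℤ} {m : ℕ} (h : (a : ZMod m) ≠ b) : ¬ (m : ℤ) ∣ a - b := by
  intro h'; apply h
  rw [← sub_eq_zero]
  exact_mod_cast (ZMod.intCast_zmod_eq_zero_iff_dvd _ m).2 h'

theorem e_shift (j k : ℤ) : e (d := d) β z hn (j + k * n) = e β z hn j := by
  apply ext_emb; intro v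
  simp only [emb_e, emb_basis, raw_single]
  rw [show j + k * n + 1 = j + 1 + k * n by ring, glue_shift, weight_shift β z (by omega) _ _ _ v.per]

theorem e_congr {i j : ℤ} (h : (i : ZMod n) = j) : e (d := d) β z hn i = e β z hn j := by
  have : (n:ℤ) ∣ i - j := by
    rw [← ZMod.intCast_zmod_eq_zero_iff_dvd]; push_cast; rw [h, sub_self]
  obtain ⟨k, hk⟩ := this
  rw [← e_shift β z hn j k]; congr 1; linarith

theorem e_comm (i j : ℤ) (h1 : (i : ZMod n) ≠ j) (h2 : (i : ZMod n) ≠ j + 1) (h3 : (j : ZMod n) ≠ i + 1) :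
    (e β z hn i * e β z hn j : Module.End ℂ (StdModule n d z)) = e β z hn j * e β z hn i := by
  apply ext_emb; intro v
  have a1 := nd_succ hn i
  have a2 := nd_succ hn j
  have b1 : ¬ (n:ℤ) ∣ i - j := nd_of h1
  have b2 : ¬ (n:ℤ) ∣ i - (j+1) := nd_of (by push_cast; exact h2)
  have b3 : ¬ (n:ℤ) ∣ i + 1 - j := nd_of (by push_cast; exact h3.symm)
  have b4 : ¬ (n:ℤ) ∣ i + 1 - (j+1) := by simpa using b1
  simp only [Module.End.mul_apply, emb_e, emb_basis, raw_single]
  rw [glue_comm a1 a2 b1 b2 b3 b4 v.per, mul_one, mul_one,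
    weight_comm β z a1 a2 b1 b2 b3 b4 (by omega) v.per]

theorem raw_symm {a b : ℤ} (hab : ¬ (n:ℤ) ∣ a - b) {f} (hf : Per n f) (c : ℂ) :
    raw n β z a b (Finsupp.single f c) = raw n β z b a (Finsupp.single f c) := by
  rw [raw_single, raw_single, glue_symm hab, weight_symm β z hab hf]

theorem raw_three {a b c : ℤ} (hab : ¬ (n:ℤ) ∣ a - b) (hbc : ¬ (n:ℤ) ∣ b - c)
    (hac : ¬ (n:ℤ) ∣ a - c) {f : ℤ → ℤ} (hf : Per n f) :
    raw n β z a b (raw n β z b c (raw n β z a b (Finsupp.single f 1))) = raw n β z a b (Finsupp.single f 1) := by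
  simp only [raw_single]
  rw [glue_three hab hbc hac hf, ← mul_assoc, weight3 hab hbc hac (glue_per hab hf) (glue_fst hab f), one_mul]

theorem nd_two (hn : 3 ≤ n) (j : ℤ) : ¬ (n:ℤ) ∣ j - (j+1+1) := by
  intro h
  have h : (n:ℤ) ∣ 2 := by have := dvd_symm h; convert this using 1; ring
  have := Int.le_of_dvd two_pos h
  omega

theorem e_succ (h3 : 3 ≤ n) (j : ℤ) :
    (e β z hn j * e β z hn (j+1) * e β z hn j : Module.End ℂ (StdModule n d z)) = e β z hn j := by
  apply ext_emb; intro v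
  simp only [Module.End.mul_apply, emb_e, emb_basis]
  exact raw_three β z (nd_succ hn j) (nd_succ hn _) (nd_two h3 j) v.per

theorem e_pred (h3 : 3 ≤ n) (j : ℤ) :
    (e β z hn (j+1) * e β z hn j * e β z hn (j+1) : Module.End ℂ (StdModule n d z)) = e β z hn (j+1) := by
  apply ext_emb; intro v
  simp only [Module.End.mul_apply, emb_e, emb_basis]
  have a1 := nd_succ hn j
  have a2 := nd_succ hn (j+1)
  have a3 := nd_two h3 j
  have b1 := mt dvd_symm a1
  have b2 := mt dvd_symm a2
  have p1 := glue_per a2 v.per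
  have p2 := glue_per a1 p1
  have := raw_three β z b2 b1 (mt dvd_symm a3) v.per
  simpa only [raw_single, glue_symm b1, glue_symm b2, weight_symm β z b2 v.per,
    weight_symm β z b1 p1, weight_symm β z b2 p2] using this
end StdModule

/-- The generators `e_j` of the periodic Temperley--Lieb algebra, `j` modulo `n`. There are none for
`n = 1`. -/
structure Gen (n : ℕ) : Type where
  idx : ZMod n
  two_le : 2 ≤ n

open FreeAlgebra in
/-- The defining relations. The relation `e_j e_{j ± 1} e_j = e_j` is present for `n ≥ 3` only: two
nodes are too few for it, as the diagram of `e_0 e_1 e_0` then has two non-contractible loops. -/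
inductive Rel (n : ℕ) (β : ℂ) : FreeAlgebra ℂ (Gen n) → FreeAlgebra ℂ (Gen n) → Prop
  | sq (h : 2 ≤ n) (j : ZMod n) : Rel n β (ι ℂ ⟨j, h⟩ * ι ℂ ⟨j, h⟩) (β • ι ℂ ⟨j, h⟩)
  | succ (h : 2 ≤ n) (h3 : 3 ≤ n) (j : ZMod n) :
      Rel n β (ι ℂ ⟨j, h⟩ * ι ℂ ⟨j + 1, h⟩ * ι ℂ ⟨j, h⟩) (ι ℂ ⟨j, h⟩)
  | pred (h : 2 ≤ n) (h3 : 3 ≤ n) (j : ZMod n) :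
      Rel n β (ι ℂ ⟨j, h⟩ * ι ℂ ⟨j - 1, h⟩ * ι ℂ ⟨j, h⟩) (ι ℂ ⟨j, h⟩)
  | comm (h : 2 ≤ n) (i j : ZMod n) (h1 : i ≠ j) (h2 : i ≠ j + 1) (h3 : j ≠ i + 1) :
      Rel n β (ι ℂ ⟨i, h⟩ * ι ℂ ⟨j, h⟩) (ι ℂ ⟨j, h⟩ * ι ℂ ⟨i, h⟩)

/-- The periodic Temperley--Lieb algebra `pTL_n(β)`. -/
def PTL (n : ℕ) (β : ℂ) : Type := RingQuot (Rel n β)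
instance (β : ℂ) : Ring (PTL n β) := inferInstanceAs (Ring (RingQuot (Rel n β)))
instance (β : ℂ) : Algebra ℂ (PTL n β) := inferInstanceAs (Algebra ℂ (RingQuot (Rel n β)))

/-- The action of the free algebra, `e_j` acting by `StdModule.e`, `0 ≤ j < n`. -/
def freeRep (n d : ℕ) (β : ℂ) (z : ℂˣ) : FreeAlgebra ℂ (Gen n) →ₐ[ℂ] Module.End ℂ (StdModule n d z) :=
  FreeAlgebra.lift ℂ fun j => StdModule.e β z j.two_le (j.idx.val : ℤ)

theorem freeRep_rel (β : ℂ) (z : ℂˣ) ⦃x y : FreeAlgebra ℂ (Gen n)⦄ (h : Rel n β x y) :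
    freeRep n d β z x = freeRep n d β z y := by
  have hv (hn : 2 ≤ n) (j : ZMod n) : (((j.val : ℕ) : ℤ) : ZMod n) = j := by
    haveI : NeZero n := ⟨by omega⟩
    simp
  induction h with
  | sq h j => simp only [freeRep, map_mul, map_smul, FreeAlgebra.lift_ι_apply]; exact StdModule.e_sq β z h _
  | succ h h3 j =>
    simp only [freeRep, map_mul, FreeAlgebra.lift_ι_apply]
    rw [StdModule.e_congr β z h (i := ((j+1).val : ℤ)) (j := (j.val : ℤ) + 1) (by push_cast; simp only [← Int.cast_natCast (R := ZMod n), hv h])]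
    exact StdModule.e_succ β z h h3 _
  | pred h h3 j =>
    simp only [freeRep, map_mul, FreeAlgebra.lift_ι_apply]
    rw [StdModule.e_congr β z h (i := (j.val : ℤ)) (j := ((j-1).val : ℤ) + 1) (by push_cast; simp only [← Int.cast_natCast (R := ZMod n), hv h]; ring)]
    exact StdModule.e_pred β z h h3 _
  | comm h i j h1 h2 h3 =>
    simp only [freeRep, map_mul, FreeAlgebra.lift_ι_apply]
    exact StdModule.e_comm β z h _ _ (by simpa only [hv h] using h1) (by simpa only [hv h] using h2) (by simpa only [hv h] using h3)

/-- The representation of `pTL_n(β)` on the standard module. -/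
def rep (n d : ℕ) (β : ℂ) (z : ℂˣ) : PTL n β →ₐ[ℂ] Module.End ℂ (StdModule n d z) :=
  RingQuot.liftAlgHom ℂ ⟨freeRep n d β z, freeRep_rel β z⟩

instance (β : ℂ) (z : ℂˣ) : Module (PTL n β) (StdModule n d z) :=
  Module.compHom _ (rep n d β z).toRingHom
instance (β : ℂ) (z : ℂˣ) : IsScalarTower ℂ (PTL n β) (StdModule n d z) where
  smul_assoc c a x := by
    change rep n d β z (c • a) x = c • rep n d β z a x
    simp
end
end PeriodicTL

/-!
The generator `e_j` acts on link states through `glue`, and only the prefactor `weight` depends on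
`z`. Replacing `z` by `-z` multiplies this prefactor by `-1` for each crossing of the periodic
boundary by the moved defect, or for a non-contractible loop. It has to be shown that this sign is
the quotient of the signs `(-1) ^ σ` of the link state before and after the action, i.e. that it
records the change of the parity of the number of arcs crossing the boundary.

This parity is additive along paths on the universal cover: whether an arc crosses an odd number of
times depends only on the parities of the numbers (`cell`) of the copies of the fundamental domain
that contain its ends. Gluing the generator with arc `(a, b)` changes at most two arcs.
* Two arcs `(a, p)`, `(b, q)` become `(a, b)`, `(p, q)`. The four form a closed path, so the parity
  is unchanged, and the prefactor is `1` (`oddEnds_glue_of_arcs`).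
* A defect at `a` and an arc `(b, q)` become `(a, b)` and a defect at `q`. The parity changes by
  `cell a - cell q`, the exponent of `z` (`oddEnds_glue_of_defect`).
* An arc from `a` to `b + k * n` becomes `(a, b)`. The parity changes by `k`, which for a planar
  pairing is `0` (prefactor `β`) or `±1` (prefactor `z + z⁻¹`) (`oddEnds_glue_of_loop`).

A count over all nodes sees each arc twice, so the comparison is made for twice the number of
crossings modulo `4` (`oddEnds`, `LinkState.oddEnds_pair`). The sign map thus intertwines the
generators, and two representations of `pTL_n(β)` that agree on the generators are equal.
-/

namespace PeriodicTL

/-! ### Parity of crossings under gluing -/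

section Signs
variable {n : ℕ}

theorem cell_add_mul (hn : 0 < n) (x k : ℤ) : cell n (x + k * n) = cell n x + k := by
  unfold cell
  rw [show x + k * n - 1 = x - 1 + k * n by ring, Int.add_mul_ediv_right _ _ (by omega)]

theorem cell_eq_zero {x : ℤ} (h1 : 1 ≤ x) (h2 : x ≤ n) : cell n x = 0 :=
  Int.ediv_eq_zero_of_lt (by omega) (by omega)

/-- The sum of a periodic function over a period is computed by any system `T` of pairwise
incongruent integers that represents all classes on which the function does not vanish. -/
theorem sum_Icc_eq_sum_of_periodic (hn : 0 < n) {D : ℤ → ℤ}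
    (hD : ∀ x y, (n : ℤ) ∣ x - y → D x = D y) (T : Finset ℤ)
    (hT : ∀ x ∈ T, ∀ y ∈ T, (n : ℤ) ∣ x - y → x = y)
    (h0 : ∀ x, (∀ y ∈ T, ¬ (n : ℤ) ∣ x - y) → D x = 0) :
    ∑ x ∈ Finset.Icc (1 : ℤ) n, D x = ∑ x ∈ T, D x := by
  choose r hr hrd using exists_rep hn
  symm
  refine Finset.sum_bij_ne_zero (fun x _ _ => r x) (fun x _ _ => hr x) ?_ ?_ ?_
  · intro x hx _ y hy _ hxy
    exact hT x hx y hy (dvd_tr (dvd_symm (hrd x)) (hxy ▸ hrd y))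
  · intro y hy hne
    by_contra hcon
    refine hne (h0 y fun x hx hyx => hcon ⟨x, hx, ?_, ?_⟩)
    · rwa [← hD y x hyx]
    · exact rep_unique (hr x) hy (dvd_tr (hrd x) (dvd_symm hyx))
  · exact fun x _ _ => (hD _ _ (hrd x)).symm

/-- `1` if the ends `x` and `f x` of an arc lie in copies of the fundamental domain whose numbers
have different parity, and `0` otherwise (in particular if `x` carries a defect). -/
def oddEnd (n : ℕ) (f : ℤ → ℤ) (x : ℤ) : ℤ := (cell n (f x) - cell n x) % 2

/-- The number of nodes that are the end of an arc crossing the boundary condition an odd number of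
times. Every such arc is counted twice, once for each end. -/
noncomputable def oddEnds (n : ℕ) (f : ℤ → ℤ) : ℤ := ∑ x ∈ Finset.Icc (1 : ℤ) n, oddEnd n f x

theorem oddEnd_congr (hn : 0 < n) {f : ℤ → ℤ} (hf : Per n f) {x y : ℤ} (h : (n : ℤ) ∣ x - y) :
    oddEnd n f x = oddEnd n f y := by
  obtain ⟨k, hk⟩ := h
  obtain rfl : x = y + k * n := by linarith
  rw [oddEnd, oddEnd, hf.mul, cell_add_mul hn, cell_add_mul hn]
  congr 1; ring

variable {a b : ℤ} {f : ℤ → ℤ}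

theorem glue_off (hf : Per n f) {x : ℤ}
    (ha : ¬ (n : ℤ) ∣ x - a) (hb : ¬ (n : ℤ) ∣ x - b)
    (hfa : ¬ (n : ℤ) ∣ x - f a) (hfb : ¬ (n : ℤ) ∣ x - f b) : glue n a b f x = f x := by
  have h {c : ℤ} (hc : ¬ (n : ℤ) ∣ x - f c) : ¬ (n : ℤ) ∣ f x - c := fun h =>
    hc (dvd_symm (hf.dvd (dvd_symm h)))
  exact glue_free (swap_off ha hb) (swap_off (h hfa) (h hfb))

/-- Only the ends of the glued arcs contribute to the change of `oddEnds`. -/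
theorem oddEnds_glue_sub (hn : 0 < n) (hab : ¬ (n : ℤ) ∣ a - b) (hf : Per n f) (T : Finset ℤ)
    (hT : ∀ x ∈ T, ∀ y ∈ T, (n : ℤ) ∣ x - y → x = y)
    (ha : a ∈ T) (hb : b ∈ T) (hfa : ∃ y ∈ T, (n : ℤ) ∣ f a - y) (hfb : ∃ y ∈ T, (n : ℤ) ∣ f b - y) :
    oddEnds n (glue n a b f) - oddEnds n f =
      ∑ x ∈ T, (oddEnd n (glue n a b f) x - oddEnd n f x) := by
  rw [oddEnds, oddEnds, ← Finset.sum_sub_distrib]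
  refine sum_Icc_eq_sum_of_periodic hn (fun x y h => ?_) T hT fun x hx => ?_
  · rw [oddEnd_congr hn (glue_per hab hf) h, oddEnd_congr hn hf h]
  · obtain ⟨p, hp, hpa⟩ := hfa
    obtain ⟨q, hq, hqb⟩ := hfb
    rw [oddEnd, oddEnd, glue_off hf (hx a ha) (hx b hb)
      (fun h => hx p hp (dvd_tr h hpa)) (fun h => hx q hq (dvd_tr h hqb)), sub_self]

/-- A loop is closed: the arc from `a` to `b + k * n` is replaced by the arc from `a` to `b`. -/
theorem oddEnds_glue_of_loop (hn : 0 < n) (hab : ¬ (n : ℤ) ∣ a - b) (hf : Per n f) {k : ℤ}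
    (hk : f a = b + k * n) : (4 : ℤ) ∣ oddEnds n (glue n a b f) - oddEnds n f - 2 * k := by
  have hfb : f b = a + (-k) * n := by
    have := hf.mul b k
    rw [← hk, hf.inv] at this
    linarith
  rw [oddEnds_glue_sub hn hab hf {a, b}, Finset.sum_pair (ne_of_nd hab)]
  · simp only [oddEnd, glue_fst hab, glue_snd hab, hk, hfb, cell_add_mul hn]
    omega
  · simp only [Finset.mem_insert, Finset.mem_singleton]
    rintro x (rfl | rfl) y (rfl | rfl) h
    exacts [rfl, absurd h hab, absurd (dvd_symm h) hab, rfl]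
  · simp
  · simp
  · exact ⟨b, by simp, by simp [hk]⟩
  · exact ⟨a, by simp, by simp [hfb]⟩

/-- A defect at `a` is moved to the other end of the arc at `b`. -/
theorem oddEnds_glue_of_defect (hn : 0 < n) (hab : ¬ (n : ℤ) ∣ a - b) (hf : Per n f)
    (ha : f a = a) (hb : f b ≠ b) :
    (4 : ℤ) ∣ oddEnds n (glue n a b f) - oddEnds n f - 2 * (cell n a - cell n (f b)) := by
  have hbm : ¬ (n : ℤ) ∣ f b - b := fun h => hb (hf.fix h)
  have ham : ¬ (n : ℤ) ∣ f b - a := fun h => hab (by simpa [ha] using hf.dvd (dvd_symm h))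
  have hs : swap n a b b = a := swap_snd hab
  have hm : glue n a b f (f b) = f b := by
    rw [glue_path (swap_off ham hbm) (by rw [hf.inv, hs]; exact ne_of_nd hab), hf.inv, hs,
      if_pos ha]
  rw [oddEnds_glue_sub hn hab hf {a, b, f b}, Finset.sum_insert, Finset.sum_pair hb.symm]
  · simp only [oddEnd, glue_fst hab, glue_snd hab, hm, ha, hf.inv]
    omega
  · simp only [Finset.mem_insert, Finset.mem_singleton, not_or]
    exact ⟨ne_of_nd hab, fun h => ham (by simp [← h])⟩
  · simp only [Finset.mem_insert, Finset.mem_singleton]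
    rintro x (rfl | rfl | rfl) y (rfl | rfl | rfl) h
    exacts [rfl, absurd h hab, absurd (dvd_symm h) ham, absurd (dvd_symm h) hab, rfl,
      absurd (dvd_symm h) hbm, absurd h ham, absurd h hbm, rfl]
  · simp
  · simp
  · exact ⟨a, by simp, by simp [ha]⟩
  · exact ⟨f b, by simp, by simp⟩

/-- Two arcs, at `a` and at `b`, are replaced by the arc of the generator and the arc between their
other ends. The two old and the two new arcs form a closed path on the cover, so that the crossings
have the same total parity. -/
theorem oddEnds_glue_of_arcs (hn : 0 < n) (hab : ¬ (n : ℤ) ∣ a - b) (hf : Per n f)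
    (ha : f a ≠ a) (hb : f b ≠ b) (hfab : ¬ (n : ℤ) ∣ f a - b) :
    (4 : ℤ) ∣ oddEnds n (glue n a b f) - oddEnds n f := by
  have haa : ¬ (n : ℤ) ∣ f a - a := fun h => ha (hf.fix h)
  have hbb : ¬ (n : ℤ) ∣ f b - b := fun h => hb (hf.fix h)
  have hfba : ¬ (n : ℤ) ∣ f b - a := fun h => hfab (hf.dvd (dvd_symm h))
  have hff : ¬ (n : ℤ) ∣ f a - f b := fun h => hab (by simpa [hf.inv] using hf.dvd h)
  have hs : swap n a b b = a := swap_snd hab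
  have hs' : swap n a b a = b := swap_fst a b
  have hga : glue n a b f (f a) = f b := by
    rw [glue_path (swap_off haa hfab) (by rw [hf.inv, hs']; exact (ne_of_nd hab).symm), hf.inv,
      hs', if_neg hb]
  have hgb : glue n a b f (f b) = f a := by rw [← hga, (glue_per hab hf).inv]
  rw [oddEnds_glue_sub hn hab hf {a, b, f a, f b}, Finset.sum_insert, Finset.sum_insert,
    Finset.sum_pair (ne_of_nd hff)]
  · simp only [oddEnd, glue_fst hab, glue_snd hab, hga, hgb, hf.inv]
    rcases Int.emod_two_eq_zero_or_one (cell n a) with h1 | h1 <;>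
    rcases Int.emod_two_eq_zero_or_one (cell n b) with h2 | h2 <;>
    rcases Int.emod_two_eq_zero_or_one (cell n (f a)) with h3 | h3 <;>
    rcases Int.emod_two_eq_zero_or_one (cell n (f b)) with h4 | h4 <;>
    simp [Int.sub_emod, h1, h2, h3, h4]
  · simp only [Finset.mem_insert, Finset.mem_singleton, not_or]
    exact ⟨(ne_of_nd hfab).symm, hb.symm⟩
  · simp only [Finset.mem_insert, Finset.mem_singleton, not_or]
    exact ⟨ne_of_nd hab, ha.symm, (ne_of_nd hfba).symm⟩
  · simp only [Finset.mem_insert, Finset.mem_singleton]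
    rintro x (rfl | rfl | rfl | rfl) y (rfl | rfl | rfl | rfl) h
    exacts [rfl, absurd h hab, absurd (dvd_symm h) haa, absurd (dvd_symm h) hfba,
      absurd (dvd_symm h) hab, rfl, absurd (dvd_symm h) hfab, absurd (dvd_symm h) hbb,
      absurd h haa, absurd h hfab, rfl, absurd h hff,
      absurd h hfba, absurd h hbb, absurd (dvd_symm h) hff, rfl]
  · simp
  · simp
  · exact ⟨f a, by simp, by simp⟩
  · exact ⟨f b, by simp, by simp⟩

/-- The sign by which the prefactor changes under `z ↦ -z` is the change of the parity of the number
of crossings. The hypothesis `hodd` holds for planar pairings, where a non-contractible loop winds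
around the annulus exactly once. -/
theorem exists_weight_neg_and_oddEnds_glue (hn : 0 < n) (hab : ¬ (n : ℤ) ∣ a - b) (hf : Per n f)
    (hodd : ∀ k : ℤ, k ≠ 0 → f a = b + k * n → Odd k) (h : ¬ (f a = a ∧ f b = b))
    (β : ℂ) (z : ℂˣ) :
    ∃ t : ℤ, weight n β (-z) a b f = (-1) ^ t * weight n β z a b f ∧
      (4 : ℤ) ∣ oddEnds n (glue n a b f) - oddEnds n f - 2 * t := by
  have hz (m : ℤ) : ((-z : ℂˣ) : ℂ) ^ m = (-1) ^ m * (z : ℂ) ^ m := by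
    rw [← mul_zpow, Units.val_neg, neg_one_mul]
  by_cases hd : (n : ℤ) ∣ f a - b
  · obtain ⟨k, hk⟩ := hd
    have hk' : f a = b + k * n := by linarith
    refine ⟨k, ?_, oddEnds_glue_of_loop hn hab hf hk'⟩
    by_cases h0 : k = 0
    · simp [weight, hk', h0]
    · have hne : f a ≠ b := by
        rw [hk', ne_eq, add_eq_left, mul_eq_zero]
        rintro (h | h) <;> omega
      have hdvd : (n : ℤ) ∣ f a - b := ⟨k, hk⟩
      rw [(hodd k h0 hk').neg_one_zpow]
      simp only [weight, hne, hdvd, if_true, if_false, Units.val_neg, inv_neg]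
      ring
  have hne : f a ≠ b := fun h => hd (by simp [h])
  by_cases ha : f a = a
  · have hb : f b ≠ b := fun hb => h ⟨ha, hb⟩
    refine ⟨_, ?_, oddEnds_glue_of_defect hn hab hf ha hb⟩
    simp only [weight, if_neg hne, if_neg hd, if_neg h, if_pos ha, hz]
  by_cases hb : f b = b
  · refine ⟨cell n b - cell n (f a), ?_, ?_⟩
    · simp only [weight, if_neg hne, if_neg hd, if_neg h, if_neg ha, if_pos hb, hz]
    · rw [glue_symm hab]
      exact oddEnds_glue_of_defect hn (mt dvd_symm hab) hf hb ha
  · refine ⟨0, ?_, by simpa using oddEnds_glue_of_arcs hn hab hf ha hb hd⟩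
    simp only [weight, if_neg hne, if_neg hd, if_neg h, if_neg ha, if_neg hb, zpow_zero, mul_one]

end Signs

/-! ### Crossings of planar link states -/

namespace LinkState
variable {n d : ℕ}

/-- An arc longer than `n` would overarch a translate of its own left end, whose arc ends farther to
the right; an arc of length exactly `n` contradicts that `pair` is a periodic involution. -/
theorem pair_lt_add (hn : 0 < n) (v : LinkState n d) (i : ℤ) : v.pair i < i + n := by
  have h1 := v.pair_add i
  have h2 := v.pair_pair i
  rcases lt_trichotomy (v.pair i) (i + n) with h | h | h
  · exact h
  · rw [h] at h1 h2
    omega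
  · have := v.planar i (i + n) (by omega) h
    omega

theorem lt_pair_add (hn : 0 < n) (v : LinkState n d) (i : ℤ) : i < v.pair i + n := by
  have := v.pair_lt_add hn (v.pair i)
  rwa [v.pair_pair] at this

theorem oddEnds_pair (hn : 0 < n) (v : LinkState n d) :
    oddEnds n v.pair = 2 * (v.crossings : ℤ) := by
  have hterm : ∀ x ∈ Finset.Icc (1 : ℤ) n, oddEnd n v.pair x =
      (if (n : ℤ) < v.pair x then 1 else 0) + (if v.pair x < 1 then 1 else 0) := by
    intro x hx
    rw [Finset.mem_Icc] at hx
    have h1 := v.pair_lt_add hn x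
    have h2 := v.lt_pair_add hn x
    rw [oddEnd, cell_eq_zero hx.1 hx.2]
    rcases lt_or_ge (n : ℤ) (v.pair x) with h | h
    · have hc := cell_add_mul hn (v.pair x - n) 1
      rw [cell_eq_zero (x := v.pair x - n) (by omega) (by omega), one_mul, sub_add_cancel] at hc
      rw [hc, if_pos h, if_neg (by omega)]
      rfl
    rcases lt_or_ge (v.pair x) 1 with h' | h'
    · have hc := cell_add_mul hn (v.pair x + n) (-1)
      rw [cell_eq_zero (x := v.pair x + n) (by omega) (by omega), neg_one_mul, add_neg_cancel_right] at hc
      rw [hc, if_neg (by omega), if_pos h']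
      rfl
    · rw [cell_eq_zero h' h, if_neg (by omega), if_neg (by omega)]
      rfl
  -- `x ↦ v.pair x - n` sends the left ends of the crossing arcs to the right ends.
  have hcard : ((Finset.Icc (1 : ℤ) n).filter fun i => v.pair i < 1).card = v.crossings := by
    symm
    have hsub (x : ℤ) : v.pair (x - n) = v.pair x - n := by
      have := v.pair_add (x - n)
      rw [sub_add_cancel] at this
      omega
    refine Finset.card_bij' (fun x _ => v.pair x - n) (fun x _ => v.pair x + n) ?_ ?_ ?_ ?_
    · intro x hx
      rw [Finset.mem_filter, Finset.mem_Icc] at hx ⊢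
      have := v.pair_lt_add hn x
      rw [hsub, v.pair_pair]
      omega
    · intro x hx
      rw [Finset.mem_filter, Finset.mem_Icc] at hx ⊢
      have := v.lt_pair_add hn x
      rw [v.pair_add, v.pair_pair]
      omega
    · intro x _
      rw [hsub, v.pair_pair, sub_add_cancel]
    · intro x _
      rw [v.pair_add, v.pair_pair, add_sub_cancel_right]
  rw [oddEnds, Finset.sum_congr rfl hterm, Finset.sum_add_distrib, Finset.sum_boole,
    Finset.sum_boole, hcard, two_mul]
  rfl

theorem neg_one_pow_parity (v : LinkState n d) :
    (-1 : ℂ) ^ v.parity = -(-1) ^ v.crossings := by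
  unfold parity
  split_ifs with h
  · simp [h.neg_one_pow]
  · simp [(Nat.not_odd_iff_even.1 h).neg_one_pow]

/-- The intertwining relation for `e_j`, as an identity between matrix coefficients. -/
theorem weight_neg_mul_neg_one_pow_parity (v : LinkState n d) (hn : 2 ≤ n) (j : ℤ)
    (h : ¬ (v.pair j = j ∧ v.pair (j + 1) = j + 1)) (β : ℂ) (z : ℂˣ) :
    weight n β (-z) j (j + 1) v.pair * (-1) ^ v.parity =
      weight n β z j (j + 1) v.pair * (-1) ^ (v.act hn j h).parity := by
  have hn0 : 0 < n := by omega
  have hodd : ∀ k : ℤ, k ≠ 0 → v.pair j = j + 1 + k * n → Odd k := by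
    -- As `|v.pair j - j| < n`, the only possibility besides `k = 0` is `k = -1`.
    intro k hk0 hk
    have h1 := v.pair_lt_add hn0 j
    have h2 := v.lt_pair_add hn0 j
    rw [hk] at h1 h2
    have hk1 : k < 1 := by
      by_contra hc
      nlinarith
    have hk2 : -2 < k := by
      by_contra hc
      nlinarith
    obtain rfl : k = -1 := by omega
    exact odd_neg_one
  obtain ⟨t, hw, hdvd⟩ :=
    exists_weight_neg_and_oddEnds_glue hn0 (nd_succ hn j) v.per hodd h β z
  have hQ : oddEnds n (glue n j (j + 1) v.pair) = 2 * ((v.act hn j h).crossings : ℤ) :=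
    (v.act hn j h).oddEnds_pair hn0
  rw [hQ, v.oddEnds_pair hn0] at hdvd
  have hpar : (-1 : ℂ) ^ (v.act hn j h).crossings = (-1) ^ t * (-1) ^ v.crossings := by
    rw [← zpow_natCast, ← zpow_natCast, ← zpow_add₀ (by simp)]
    obtain ⟨m, hm⟩ := hdvd
    rw [show ((v.act hn j h).crossings : ℤ) = t + v.crossings + 2 * m by omega,
      zpow_add₀ (by simp) _ (2 * m), zpow_mul]
    simp
  rw [neg_one_pow_parity, neg_one_pow_parity, hpar, hw]
  ring

end LinkState

/-! ### The sign map intertwines the representations -/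

noncomputable section
namespace StdModule
variable {n d : ℕ}

/-- The map that multiplies each link state `v` by `(-1) ^ σ_v`. -/
def signEquiv (n d : ℕ) (z : ℂˣ) : StdModule n d z ≃ₗ[ℂ] StdModule n d (-z) :=
  (basis n d z).equiv
    ((basis n d (-z)).unitsSMul fun v : LinkState n d => (-1 : ℂˣ) ^ v.parity) (Equiv.refl _)

theorem signEquiv_basis (z : ℂˣ) (v : LinkState n d) :
    signEquiv n d z (basis n d z v) = (-1 : ℂ) ^ v.parity • basis n d (-z) v := by
  rw [signEquiv, Module.Basis.equiv_apply, Equiv.refl_apply, Module.Basis.unitsSMul_apply,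
    Units.smul_def]
  simp

theorem signEquiv_e (β : ℂ) (z : ℂˣ) (hn : 2 ≤ n) (j : ℤ) (x : StdModule n d z) :
    signEquiv n d z (e β z hn j x) = e β (-z) hn j (signEquiv n d z x) := by
  suffices (signEquiv n d z).toLinearMap ∘ₗ e β z hn j =
      e β (-z) hn j ∘ₗ (signEquiv n d z).toLinearMap from LinearMap.congr_fun this x
  refine (basis n d z).ext fun v => ?_
  simp only [LinearMap.comp_apply, LinearEquiv.coe_coe, signEquiv_basis, map_smul, e,
    Module.Basis.constr_basis]
  split_ifs with h
  · simp
  · rw [map_smul, signEquiv_basis, smul_smul, smul_smul,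
      ← v.weight_neg_mul_neg_one_pow_parity hn j h, mul_comm]

theorem rep_generator (β : ℂ) (z : ℂˣ) (g : Gen n) :
    rep n d β z (RingQuot.mkAlgHom ℂ (Rel n β) (FreeAlgebra.ι ℂ g)) =
      e β z g.two_le (g.idx.val : ℤ) := by
  refine (RingQuot.liftAlgHom_mkAlgHom_apply ℂ (freeRep n d β z) (freeRep_rel β z) _).trans ?_
  rw [freeRep, FreeAlgebra.lift_ι_apply]

theorem conj_signEquiv_rep (β : ℂ) (z : ℂˣ) :
    ((signEquiv n d z).conjAlgEquiv ℂ).toAlgHom.comp (rep n d β z) = rep n d β (-z) := by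
  -- Both sides are algebra homomorphisms, so it is enough to compare them on the generators.
  refine RingQuot.ringQuot_ext' _ _ _ (FreeAlgebra.hom_ext (funext fun g => ?_))
  refine LinearMap.ext fun x => ?_
  change signEquiv n d z (rep n d β z (RingQuot.mkAlgHom ℂ (Rel n β) (FreeAlgebra.ι ℂ g))
    ((signEquiv n d z).symm x)) = rep n d β (-z) (RingQuot.mkAlgHom ℂ (Rel n β) (FreeAlgebra.ι ℂ g)) x
  rw [rep_generator, rep_generator, signEquiv_e, LinearEquiv.apply_symm_apply]

theorem signEquiv_smul (β : ℂ) (z : ℂˣ) (a : PTL n β) (x : StdModule n d z) :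
    signEquiv n d z (a • x) = a • signEquiv n d z x := by
  change signEquiv n d z (rep n d β z a x) = rep n d β (-z) a (signEquiv n d z x)
  rw [← conj_signEquiv_rep]
  simp

end StdModule
end
end PeriodicTL

theorem mainTheorem8 (n d : ℕ) (hn : 1 ≤ n) (hd : d ≤ n) (hdn : d ≡ n [MOD 2]) (β : ℂ) (z : ℂˣ) :
    ∃ Φ : PeriodicTL.StdModule n d z ≃ₗ[PeriodicTL.PTL n β] PeriodicTL.StdModule n d (-z),
      ∀ v : PeriodicTL.LinkState n d,
        Φ (PeriodicTL.StdModule.basis n d z v) =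
          (-1 : ℂ) ^ v.parity • PeriodicTL.StdModule.basis n d (-z) v :=
  ⟨{ PeriodicTL.StdModule.signEquiv n d z with
      map_smul' := PeriodicTL.StdModule.signEquiv_smul β z },
    PeriodicTL.StdModule.signEquiv_basis z⟩
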